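/- Let $X$ be a topological space, let $SP^2(X)=(X\times X)/(\mathbb{Z}/2)$ be its symmetric square (the orbit space of the involution $(x,y)\mapsto(y,x)$, with the quotient topology), and let $dX\subseteq SP^2(X)$ be the image of the diagonal $\Delta X\subseteq X\times X$. Let $PX$ be the space of paths $[0,1]\to X$ with the compact-open topology. The monoidal symmetrized topological complexity $\mathsf{TC}^{M,\Sigma}(X)\in\mathbb{N}\cup\{\infty\}$ is the least integer $m\ge 0$ such that $X\times X$ can be covered by open sets $U_0,\ldots,U_m$, each invariant under the involution and containing $\Delta X$, and each admitting a continuous map $\sigma_i:U_i\to PX$ such that $\sigma_i(x,y)$ is a path from $x$ to $y$, $\sigma_i(y,x)$ is the reverse of $\sigma_i(x,y)$, and $\sigma_i(x,x)$ is the constant path at $x$ (it is $\infty$ if there is no such $m$). Let $k\ge 1$, let $A_1,\ldots,A_k$ and $M$ be abelian groups, and let $\mu:A_1\times\cdots\times A_k\to M$ be a multiadditive map (for instance the multiplication of a ring $R=A_1=\cdots=A_k=M$, or the universal map to $M=A_1\otimes\cdots\otimes A_k$). Suppose there are relative singular cohomology classes $x_i\in H^*(SP^2(X),dX;A_i)$,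 $i=1,\ldots,k$, whose cup product with respect to $\mu$ is nonzero: $$0\neq x_1\cdots x_k\in H^*(SP^2(X),dX;M).$$ Then $\mathsf{TC}^{M,\Sigma}(X)\ge k$. -/

import Mathlib

open scoped DirectSum TensorProduct

universe u v w

namespace RelSing

noncomputable section

/-- The set of singular `n`-simplices of `Y`: continuous maps from the standard `n`-simplex. -/
abbrev Simplex (Y : Type u) [TopologicalSpace Y] (n : ℕ) : Type u :=
  C(stdSimplex ℝ (Fin (n + 1)), Y)

/-- Precomposition of a singular simplex with the affine map of standard simplices that sends the
`i`-th vertex to the `θ i`-th vertex. -/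
def Simplex.pull {Y : Type u} [TopologicalSpace Y] {m n : ℕ} (θ : Fin (m + 1) → Fin (n + 1))
    (σ : Simplex Y n) : Simplex Y m :=
  σ.comp ⟨stdSimplex.map θ, stdSimplex.continuous_map θ⟩

theorem Simplex.pull_pull {Y : Type u} [TopologicalSpace Y] {l m n : ℕ}
    (η : Fin (l + 1) → Fin (m + 1)) (θ : Fin (m + 1) → Fin (n + 1)) (σ : Simplex Y n) :
    (σ.pull θ).pull η = σ.pull (θ ∘ η) := by
  ext t
  simp [Simplex.pull, stdSimplex.map_comp_apply]

theorem Simplex.pull_mem {Y : Type u} [TopologicalSpace Y] {B : Set Y} {m n : ℕ}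
    (θ : Fin (m + 1) → Fin (n + 1)) {σ : Simplex Y n} (h : ∀ t, σ t ∈ B) (t) :
    σ.pull θ t ∈ B := h _

/-- Vertices `0, …, p` of the `n`-simplex, where `p + q = n`. -/
def frontIdx {p q n : ℕ} (h : p + q = n) (i : Fin (p + 1)) : Fin (n + 1) :=
  ⟨i.1, by omega⟩

/-- Vertices `p, …, n` of the `n`-simplex, where `p + q = n`. -/
def backIdx {p q n : ℕ} (h : p + q = n) (j : Fin (q + 1)) : Fin (n + 1) :=
  ⟨p + j.1, by omega⟩

variable {Y : Type u} [TopologicalSpace Y]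

/-- The singular coboundary `(δ f)(σ) = ∑ i, (-1)^i f(σ ∘ dᵢ)`. -/
def coboundary (Y : Type u) [TopologicalSpace Y] (A : Type v) [AddCommGroup A] (n : ℕ) :
    (Simplex Y n → A) →+ (Simplex Y (n + 1) → A) :=
  AddMonoidHom.mk'
    (fun f σ => ∑ i : Fin (n + 2), (-1 : ℤ) ^ (i : ℕ) • f (σ.pull i.succAbove))
    (by intro f g; funext σ; simp [Finset.sum_add_distrib])

theorem coboundary_apply {A : Type v} [AddCommGroup A] {n : ℕ} (f : Simplex Y n → A)
    (σ : Simplex Y (n + 1)) : coboundary Y A n f σ =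
      ∑ i : Fin (n + 2), (-1 : ℤ) ^ (i : ℕ) • f (σ.pull i.succAbove) := rfl

/-- Relative singular `n`-cochains of the pair `(Y, B)`: the functions on singular `n`-simplices
of `Y` that vanish on the simplices lying in `B`. -/
def cochains (B : Set Y) (A : Type v) [AddCommGroup A] (n : ℕ) :
    AddSubgroup (Simplex Y n → A) where
  carrier := {f | ∀ σ : Simplex Y n, (∀ t, σ t ∈ B) → f σ = 0}
  zero_mem' := fun _ _ => rfl
  add_mem' := by
    intro f g hf hg σ hσ
    simp [hf σ hσ, hg σ hσ]
  neg_mem' := by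
    intro f hf σ hσ
    simp [hf σ hσ]

/-- Relative singular `n`-cocycles of `(Y, B)`. -/
def cocycles (B : Set Y) (A : Type v) [AddCommGroup A] (n : ℕ) :
    AddSubgroup (Simplex Y n → A) :=
  cochains B A n ⊓ (coboundary Y A n).ker

/-- Relative singular `n`-coboundaries of `(Y, B)`. -/
def coboundaries (B : Set Y) (A : Type v) [AddCommGroup A] : (n : ℕ) →
    AddSubgroup (Simplex Y n → A)
  | 0 => ⊥
  | n + 1 => (cochains B A n).map (coboundary Y A n)

/-- The relative singular cohomology group `H^n(Y, B; A)`. -/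
abbrev H (B : Set Y) (A : Type v) [AddCommGroup A] (n : ℕ) : Type (max u v) :=
  cocycles B A n ⧸ (coboundaries B A n).addSubgroupOf (cocycles B A n)

/-- The graded group `H^*(Y, B; A)`, the direct sum of the groups `H^n(Y, B; A)`. -/
abbrev Htot (B : Set Y) (A : Type v) [AddCommGroup A] : Type (max u v) :=
  ⨁ n : ℕ, H B A n

section Coeff

variable {A : Type v} [AddCommGroup A] {A' : Type w} [AddCommGroup A']

theorem coboundary_comp (φ : A →+ A') {n : ℕ} (f : Simplex Y n → A) :
    coboundary Y A' n (fun σ => φ (f σ)) = fun σ => φ (coboundary Y A n f σ) := by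
  funext σ
  simp [coboundary_apply, map_sum, map_zsmul]

/-- Change of coefficients on cocycles. -/
def coeffCocycles (B : Set Y) (φ : A →+ A') (n : ℕ) : cocycles B A n →+ cocycles B A' n :=
  AddMonoidHom.mk'
    (fun f => ⟨fun σ => φ (f.1 σ), by
      refine ⟨fun σ hσ => by simp [f.2.1 σ hσ], ?_⟩
      have h := AddMonoidHom.mem_ker.1 f.2.2
      refine AddMonoidHom.mem_ker.2 ?_
      rw [coboundary_comp, h]
      funext σ
      simp⟩)
    (by intro f g; ext σ; simp)

theorem coeffCocycles_mem (B : Set Y) (φ : A →+ A') (n : ℕ) :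
    (coboundaries B A n).addSubgroupOf (cocycles B A n) ≤
      ((coboundaries B A' n).addSubgroupOf (cocycles B A' n)).comap (coeffCocycles B φ n) := by
  intro f hf
  rw [AddSubgroup.mem_comap, AddSubgroup.mem_addSubgroupOf]
  rw [AddSubgroup.mem_addSubgroupOf] at hf
  cases n with
  | zero =>
    have h : f.1 = 0 := hf
    change (fun σ => φ (f.1 σ)) = 0
    rw [h]
    funext σ
    simp
  | succ n =>
    obtain ⟨g, hg, hgf⟩ := hf
    refine ⟨fun σ => φ (g σ), fun σ hσ => by simp [hg σ hσ], ?_⟩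
    rw [coboundary_comp, hgf]
    rfl

/-- Change of coefficients `H^n(Y, B; A) → H^n(Y, B; A')`. -/
def coeffH (B : Set Y) (φ : A →+ A') (n : ℕ) : H B A n →+ H B A' n :=
  QuotientAddGroup.map _ _ (coeffCocycles B φ n) (coeffCocycles_mem B φ n)

/-- Change of coefficients `H^*(Y, B; A) → H^*(Y, B; A')`. -/
def coeffMap (B : Set Y) (φ : A →+ A') : Htot B A →+ Htot B A' :=
  DirectSum.map fun n => coeffH B φ n

end Coeff

section Cup

universe v₁ v₂ v₃

variable {A₁ : Type v₁} {A₂ : Type v₂} {A₃ : Type v₃}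
variable [AddCommGroup A₁] [AddCommGroup A₂] [AddCommGroup A₃]

/-- The cochain-level cup product for a biadditive pairing `μ` of coefficient groups:
`(f ⌣ g)(σ) = μ (f(front p-face of σ)) (g(back q-face of σ))`. -/
def cupFun (μ : A₁ →+ A₂ →+ A₃) {p q n : ℕ} (h : p + q = n)
    (f : Simplex Y p → A₁) (g : Simplex Y q → A₂) : Simplex Y n → A₃ :=
  fun σ => μ (f (σ.pull (frontIdx h))) (g (σ.pull (backIdx h)))

/-- The Leibniz rule. -/
theorem coboundary_cupFun (μ : A₁ →+ A₂ →+ A₃) {p q n : ℕ} (h : p + q = n)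
    (f : Simplex Y p → A₁) (g : Simplex Y q → A₂) :
    coboundary Y A₃ n (cupFun μ h f g) =
      cupFun μ (by omega : (p + 1) + q = n + 1) (coboundary Y A₁ p f) g +
        (-1 : ℤ) ^ p • cupFun μ (by omega : p + (q + 1) = n + 1) f (coboundary Y A₂ q g) := by
  funext σ
  have h1 : (p + 1) + q = n + 1 := by omega
  have h2 : p + (q + 1) = n + 1 := by omega
  have e : (p + 1) + (q + 1) = n + 2 := by omega
  simp only [coboundary_apply, cupFun, Pi.add_apply, Pi.smul_apply, map_sum, map_zsmul,
    AddMonoidHom.finsetSum_apply, AddMonoidHom.coe_smul, Simplex.pull_pull]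
  rw [← Fin.sum_congr' _ e, Fin.sum_univ_add, Fin.sum_univ_castSucc (n := p + 1),
    Fin.sum_univ_succ (n := q + 1)]
  have a1 : ∀ a : Fin (p + 1), (Fin.cast e (Fin.castAdd (q + 1) a)).succAbove ∘ frontIdx h =
      frontIdx h1 ∘ (Fin.castSucc a).succAbove := by
    intro a
    funext i
    ext
    simp only [Function.comp, frontIdx, Fin.succAbove, Fin.lt_def]
    split_ifs <;> simp_all <;> omega
  have a2 : ∀ a : Fin (p + 1), (Fin.cast e (Fin.castAdd (q + 1) a)).succAbove ∘ backIdx h =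
      backIdx h1 := by
    intro a
    funext i
    ext
    simp only [Function.comp, backIdx, Fin.succAbove, Fin.lt_def]
    split_ifs <;> simp_all <;> omega
  have b1 : ∀ b : Fin (q + 1), (Fin.cast e (Fin.natAdd (p + 1) b)).succAbove ∘ frontIdx h =
      frontIdx h2 := by
    intro b
    funext i
    ext
    simp only [Function.comp, frontIdx, Fin.succAbove, Fin.lt_def]
    split_ifs <;> simp_all <;> omega
  have b2 : ∀ b : Fin (q + 1), (Fin.cast e (Fin.natAdd (p + 1) b)).succAbove ∘ backIdx h =
      backIdx h2 ∘ (Fin.succ b).succAbove := by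
    intro b
    funext i
    ext
    simp only [Function.comp, backIdx, Fin.succAbove, Fin.lt_def]
    split_ifs <;> simp_all <;> omega
  have c1 : frontIdx h1 ∘ (Fin.last (p + 1)).succAbove = frontIdx h2 := by
    funext i
    ext
    simp [frontIdx]
  have c2 : backIdx h2 ∘ (0 : Fin (q + 2)).succAbove = backIdx h1 := by
    funext i
    ext
    simp [backIdx]
    omega
  simp only [a1, a2, b1, b2, c1, c2]
  simp only [Fin.val_cast, Fin.val_castAdd, Fin.val_natAdd, Fin.val_castSucc, Fin.val_last,
    Fin.val_zero, Fin.val_succ, pow_zero, one_smul, smul_add, Finset.smul_sum, smul_smul]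
  refine Eq.trans ?_ (add_assoc _ _ _).symm
  congr 1
  refine Eq.trans ?_ (add_assoc _ _ _)
  rw [← add_smul, pow_succ]
  simp only [mul_neg, mul_one, neg_add_cancel, zero_smul, zero_add]
  refine Finset.sum_congr rfl fun b _ => ?_
  congr 1
  ring

/-- The cup product of relative cocycles. -/
theorem cupFun_mem_cocycles (B : Set Y) (μ : A₁ →+ A₂ →+ A₃) {p q n : ℕ} (h : p + q = n)
    {f : Simplex Y p → A₁} {g : Simplex Y q → A₂} (hf : f ∈ cocycles B A₁ p)
    (hg : g ∈ cocycles B A₂ q) : cupFun μ h f g ∈ cocycles B A₃ n := by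
  refine ⟨fun σ hσ => ?_, ?_⟩
  · have := hf.1 _ (Simplex.pull_mem (frontIdx h) hσ)
    simp [cupFun, this]
  · have h1 := AddMonoidHom.mem_ker.1 hf.2
    have h2 := AddMonoidHom.mem_ker.1 hg.2
    refine AddMonoidHom.mem_ker.2 ?_
    rw [coboundary_cupFun, h1, h2]
    funext σ
    simp [cupFun]

/-- The product of a cocycle and a coboundary is a coboundary. -/
theorem cupFun_mem_coboundaries_right (B : Set Y) (μ : A₁ →+ A₂ →+ A₃) {p q n : ℕ}
    (h : p + q = n) {f : Simplex Y p → A₁} {g : Simplex Y q → A₂} (hf : f ∈ cocycles B A₁ p)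
    (hg : g ∈ coboundaries B A₂ q) : cupFun μ h f g ∈ coboundaries B A₃ n := by
  cases q with
  | zero =>
    have h0 : g = 0 := hg
    have : cupFun μ h f g = 0 := by
      funext σ
      simp [cupFun, h0]
    rw [this]
    exact zero_mem _
  | succ q =>
    obtain ⟨g, hg, rfl⟩ := hg
    subst h
    have h1 := AddMonoidHom.mem_ker.1 hf.2
    refine ⟨(-1 : ℤ) ^ p • cupFun μ rfl f g, AddSubgroup.zsmul_mem _ (fun σ hσ => ?_) _, ?_⟩
    · have := hf.1 _ (Simplex.pull_mem (frontIdx rfl) hσ)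
      simp [cupFun, this]
    · rw [map_zsmul, coboundary_cupFun, h1, smul_add, smul_smul, ← mul_pow]
      funext σ
      simp [cupFun]

/-- The product of a coboundary and a cocycle is a coboundary. -/
theorem cupFun_mem_coboundaries_left (B : Set Y) (μ : A₁ →+ A₂ →+ A₃) {p q n : ℕ}
    (h : p + q = n) {f : Simplex Y p → A₁} {g : Simplex Y q → A₂}
    (hf : f ∈ coboundaries B A₁ p) (hg : g ∈ cocycles B A₂ q) :
    cupFun μ h f g ∈ coboundaries B A₃ n := by
  cases p with
  | zero =>
    have h0 : f = 0 := hf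
    have : cupFun μ h f g = 0 := by
      funext σ
      simp [cupFun, h0]
    rw [this]
    exact zero_mem _
  | succ p =>
    obtain ⟨f, hf, rfl⟩ := hf
    obtain ⟨n, rfl⟩ : ∃ m, n = m + 1 := ⟨p + q, by omega⟩
    have h' : p + q = n := by omega
    have h2 := AddMonoidHom.mem_ker.1 hg.2
    refine ⟨cupFun μ h' f g, fun σ hσ => ?_, ?_⟩
    · have := hf _ (Simplex.pull_mem (frontIdx h') hσ)
      simp [cupFun, this]
    · rw [coboundary_cupFun, h2]
      funext σ
      simp [cupFun]

/-- The cup product of relative cocycles, as a biadditive map. -/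
def cupCocycles (B : Set Y) (μ : A₁ →+ A₂ →+ A₃) (p q : ℕ) :
    cocycles B A₁ p →+ cocycles B A₂ q →+ cocycles B A₃ (p + q) :=
  AddMonoidHom.mk'
    (fun f => AddMonoidHom.mk'
      (fun g => ⟨cupFun μ rfl f.1 g.1, cupFun_mem_cocycles B μ rfl f.2 g.2⟩)
      (by intro g g'; ext σ; simp [cupFun]))
    (by intro f f'; ext g σ; simp [cupFun])

/-- The cup product `H^p(Y, B; A₁) × H^q(Y, B; A₂) → H^{p+q}(Y, B; A₃)` induced by a biadditive
pairing `A₁ × A₂ → A₃`. -/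
def cupH (B : Set Y) (μ : A₁ →+ A₂ →+ A₃) (p q : ℕ) :
    H B A₁ p →+ H B A₂ q →+ H B A₃ (p + q) :=
  QuotientAddGroup.lift _
    (AddMonoidHom.mk'
      (fun f => QuotientAddGroup.map _ _ (cupCocycles B μ p q f) (by
        intro g hg
        rw [AddSubgroup.mem_addSubgroupOf] at hg
        exact cupFun_mem_coboundaries_right B μ rfl f.2 hg))
      (by
        intro f f'
        ext g
        simp
        rfl))
    (by
      intro f hf
      rw [AddSubgroup.mem_addSubgroupOf] at hf
      ext g
      exact (QuotientAddGroup.eq_zero_iff _).2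
        (cupFun_mem_coboundaries_left B μ rfl hf g.2))

/-- The cup product on `H^*(Y, B; -)`, extended biadditively from homogeneous classes. -/
def cup (B : Set Y) (μ : A₁ →+ A₂ →+ A₃) : Htot B A₁ →+ Htot B A₂ →+ Htot B A₃ :=
  DirectSum.toAddMonoid fun p => AddMonoidHom.flip <| DirectSum.toAddMonoid fun q =>
    AddMonoidHom.flip <|
      (AddMonoidHom.compHom (DirectSum.of (fun n => H B A₃ n) (p + q))).comp (cupH B μ p q)

end Cup

section Iterated

/-- The canonical map `A → ⨂ i : Fin 1, A i`, `a ↦ ⨂ a`. -/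
def tensorOne (A : Fin 1 → Type v) [∀ i, AddCommGroup (A i)] : A 0 →+ (⨂[ℤ] i, A i) :=
  AddMonoidHom.mk'
    (fun a => PiTensorProduct.tprod ℤ (Fin.cons a (fun i => i.elim0) : ∀ i, A i))
    (fun a b => (PiTensorProduct.tprod ℤ (s := A)).cons_add (fun i => i.elim0) a b)

/-- The canonical pairing `A₀ × (A₁ ⊗ ⋯ ⊗ Aₙ) → A₀ ⊗ A₁ ⊗ ⋯ ⊗ Aₙ`,
`(a, b) ↦ a ⊗ b`. -/
def tensorCons {n : ℕ} (A : Fin (n + 1) → Type v) [∀ i, AddCommGroup (A i)] :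
    A 0 →+ (⨂[ℤ] i : Fin n, A i.succ) →+ (⨂[ℤ] i, A i) :=
  AddMonoidHom.mk'
    (fun a => (PiTensorProduct.lift
      ((PiTensorProduct.tprod ℤ (s := A)).curryLeft a)).toAddMonoidHom)
    (by intro a b; ext t; simp)

/-- The iterated cup product `x₀ ⌣ x₁ ⌣ ⋯ ⌣ xₙ ∈ H^*(Y, B; A₀ ⊗ ⋯ ⊗ Aₙ)` of classes
`xᵢ ∈ H^*(Y, B; Aᵢ)`. -/
def cupTensor (B : Set Y) : (n : ℕ) → (A : Fin (n + 1) → Type v) → [∀ i, AddCommGroup (A i)] →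
    (∀ i, Htot B (A i)) → Htot B (⨂[ℤ] i, A i)
  | 0, A, _, x => coeffMap B (tensorOne A) (x 0)
  | n + 1, A, _, x =>
      cup B (tensorCons A) (x 0) (cupTensor B n (fun i => A i.succ) (fun i => x i.succ))

/-- The iterated cup product `x₀ ⌣ x₁ ⌣ ⋯ ⌣ xₙ ∈ H^*(Y, B; M)` of classes
`xᵢ ∈ H^*(Y, B; Aᵢ)` with respect to a multiadditive pairing `μ : A₀ × ⋯ × Aₙ → M`. If all `Aᵢ`
and `M` are one ring `R` and `μ` is its multiplication, this is the product in `H^*(Y, B; R)`; if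
`μ` is the universal pairing, it is the product in `H^*(Y, B; A₀ ⊗ ⋯ ⊗ Aₙ)`. -/
def cupProduct (B : Set Y) {n : ℕ} {A : Fin (n + 1) → Type v} [∀ i, AddCommGroup (A i)]
    {M : Type w} [AddCommGroup M] (μ : MultilinearMap ℤ A M) (x : ∀ i, Htot B (A i)) :
    Htot B M :=
  coeffMap B (PiTensorProduct.lift μ).toAddMonoidHom (cupTensor B n A x)

end Iterated

end

end RelSing

/-- The symmetric square of `X`: the orbit space of `X × X` under transposition, with the quotient
topology. -/
abbrev SymmSquare (X : Type u) : Type u := Sym2 X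

/-- The image in the symmetric square of the diagonal of `X × X`. -/
abbrev SymmSquare.diagonal (X : Type u) : Set (SymmSquare X) :=
  (fun p : X × X => (Sym2.mk p.1 p.2 : SymmSquare X)) '' Set.diagonal X

/-- A subset `U` of `X × X` carries an equivariant motion planner that is constant on the diagonal:
`U` is open, invariant under transposition, contains the diagonal, and there is a continuous map
`s` from `U` to the space of paths in `X` (compact-open topology) such that `s (x, y)` runs from
`x` to `y`, `s (y, x)` is the reverse of `s (x, y)`, and `s (x, x)` is constant. -/
structure IsMonoidalSymmetricDomain {X : Type u} [TopologicalSpace X] (U : Set (X × X)) :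
    Prop where
  isOpen : IsOpen U
  swap_mem : ∀ p ∈ U, p.swap ∈ U
  diagonal_subset : Set.diagonal X ⊆ U
  exists_section : ∃ s : C(U, C(unitInterval, X)),
    (∀ p : U, s p 0 = p.1.1 ∧ s p 1 = p.1.2) ∧
    (∀ (p : U) (t : unitInterval),
      s ⟨p.1.swap, swap_mem p.1 p.2⟩ t = s p (unitInterval.symm t)) ∧
    (∀ (x : X) (t : unitInterval), s ⟨(x, x), diagonal_subset rfl⟩ t = x)

/-- The monoidal symmetrized topological complexity of `X`: the least `k` such that `X × X` is
covered by `k + 1` sets as above, and `∞` if there is no such `k`. -/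
noncomputable def monoidalSymmetrizedTC (X : Type u) [TopologicalSpace X] : ℕ∞ :=
  ⨅ (k : ℕ) (_ : ∃ U : Fin (k + 1) → Set (X × X),
    (∀ i, IsMonoidalSymmetricDomain (U i)) ∧ ⋃ i, U i = Set.univ), (k : ℕ∞)

/-! Let `π` be the projection of `X × X` onto the symmetric square and `B` the image of the
diagonal. A motion planner `s` on `U` deforms `π '' U` into `B` inside the symmetric square: both
ends of the path `s (x, y)` are moved to its midpoint, giving the unordered pair of `s (x, y) (t /
2)` and `s (x, y) (1 - t / 2)`. Equivariance makes this well defined on unordered pairs, and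
constancy on the diagonal keeps `B` in `B` (`IsMonoidalSymmetricDomain.exists_deformation`).

Such a deformation lets every relative class be represented by cocycles that vanish on all simplices
in `π '' U` (`smallClasses_eq_top`, by the prism operator). If at most as many planners as classes
cover `X × X`, assign a set `V i` to each `x i` so that the `V i` cover. A simplex inside `V i` has
its front and back faces there too, so the cochain-level product vanishes on every simplex that lies
in some `V i` (`cup_mem_smallClasses`).

A cocycle vanishing on the small simplices of an open cover is the coboundary of a cochain with the
same property, by barycentric subdivision (`exists_coboundary_eq_of_small`). Since `B` lies in each
`V i`, this cochain is relative and the product is zero (`smallClasses_eq_bot`). Using only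
vanishing on small simplices avoids the relative groups of the pairs with subspaces `V i` and their
unions. -/

namespace RelSing

noncomputable section

/-! ### Ordered chains: cones, subdivision and inductively built homotopies. -/

/-- Augmented ordered chains on a set `K`: formal integral combinations of `p`-tuples of elements
of `K`. The empty tuple spans the augmentation term `p = 0`. -/
abbrev TupleChain (K : Type*) (p : ℕ) := FreeAbelianGroup (Fin p → K)

namespace TupleChain

open FreeAbelianGroup

variable {K L K' L' : Type*}

/-- The simplicial boundary of ordered chains. -/
def boundary (K : Type*) (p : ℕ) : TupleChain K (p + 1) →+ TupleChain K p :=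
  lift fun w => ∑ i : Fin (p + 1), (-1 : ℤ) ^ (i : ℕ) • of (w ∘ i.succAbove)

theorem boundary_of {p : ℕ} (w : Fin (p + 1) → K) : boundary K p (of w) =
    ∑ i : Fin (p + 1), (-1 : ℤ) ^ (i : ℕ) • of (w ∘ i.succAbove) :=
  lift_apply_of _ _

/-- Adjoining a first vertex. -/
def cone (b : K) (p : ℕ) : TupleChain K p →+ TupleChain K (p + 1) :=
  map (Fin.cons (α := fun _ => K) b)

theorem cone_of (b : K) {p : ℕ} (w : Fin p → K) :
    cone b p (of w) = of (Fin.cons (α := fun _ => K) b w) :=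
  map_of_apply _

/-- The map of chains induced by a map of vertices. -/
def push (φ : K → L) (p : ℕ) : TupleChain K p →+ TupleChain L p :=
  map (φ ∘ ·)

theorem push_of (φ : K → L) {p : ℕ} (w : Fin p → K) : push φ p (of w) = of (φ ∘ w) :=
  map_of_apply _

theorem boundary_push (φ : K → L) {p : ℕ} (c : TupleChain K (p + 1)) :
    boundary L p (push φ (p + 1) c) = push φ p (boundary K p c) := by
  suffices (boundary L p).comp (push φ (p + 1)) = (push φ p).comp (boundary K p) from
    DFunLike.congr_fun this c
  refine lift_ext _ _ fun w => ?_
  simp [boundary_of, push_of, map_sum, Function.comp_assoc]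

theorem push_cone (φ : K → L) (b : K) {p : ℕ} (c : TupleChain K p) :
    push φ (p + 1) (cone b p c) = cone (φ b) p (push φ p c) := by
  suffices (push φ (p + 1)).comp (cone b p) = (cone (φ b) p).comp (push φ p) from
    DFunLike.congr_fun this c
  refine lift_ext _ _ fun w => ?_
  simp only [AddMonoidHom.comp_apply, cone_of, push_of]
  congr 1
  funext i
  cases i using Fin.cases <;> simp

theorem boundary_cone_zero (b : K) (c : TupleChain K 0) : boundary K 0 (cone b 0 c) = c := by
  suffices (boundary K 0).comp (cone b 0) = AddMonoidHom.id _ from DFunLike.congr_fun this c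
  refine lift_ext _ _ fun w => ?_
  simp only [AddMonoidHom.comp_apply, cone_of, boundary_of, AddMonoidHom.id_apply]
  rw [Fin.sum_univ_succ, Finset.univ_eq_empty, Finset.sum_empty, add_zero, Fin.val_zero, pow_zero,
    one_smul]
  exact congrArg of (Subsingleton.elim _ _)

theorem boundary_cone (b : K) {p : ℕ} (c : TupleChain K (p + 1)) :
    boundary K (p + 1) (cone b (p + 1) c) = c - cone b p (boundary K p c) := by
  suffices (boundary K (p + 1)).comp (cone b (p + 1)) =
      AddMonoidHom.id _ - (cone b p).comp (boundary K p) from DFunLike.congr_fun this c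
  refine lift_ext _ _ fun w => ?_
  have h0 : Fin.cons (α := fun _ => K) b w ∘ (0 : Fin (p + 2)).succAbove = w := by
    funext i
    simp
  have hs (i : Fin (p + 1)) : Fin.cons (α := fun _ => K) b w ∘ i.succ.succAbove =
      Fin.cons (α := fun _ => K) b (w ∘ i.succAbove) := by
    funext j
    cases j using Fin.cases <;> simp
  simp only [AddMonoidHom.comp_apply, AddMonoidHom.sub_apply, AddMonoidHom.id_apply, cone_of,
    boundary_of, Fin.sum_univ_succ (n := p + 1), h0, hs, map_sum, map_zsmul]
  simp [pow_succ, sub_eq_add_neg]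

/-- Each nonempty tuple is the cone from its first vertex over its tail, so two uses of the cone
formula reduce the claim to one degree lower. -/
theorem boundary_boundary {p : ℕ} (c : TupleChain K (p + 2)) :
    boundary K p (boundary K (p + 1) c) = 0 := by
  induction p with
  | zero =>
    suffices (boundary K 0).comp (boundary K 1) = 0 from DFunLike.congr_fun this c
    refine lift_ext _ _ fun w => ?_
    rw [← Fin.cons_self_tail w, ← cone_of, AddMonoidHom.comp_apply, boundary_cone, map_sub,
      boundary_cone_zero, sub_self, AddMonoidHom.zero_apply]
  | succ p ih =>
    suffices (boundary K (p + 1)).comp (boundary K (p + 2)) = 0 from DFunLike.congr_fun this c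
    refine lift_ext _ _ fun w => ?_
    rw [← Fin.cons_self_tail w, ← cone_of, AddMonoidHom.comp_apply, boundary_cone, map_sub,
      boundary_cone, ih, map_zero, sub_zero, sub_self, AddMonoidHom.zero_apply]

/-- The subdivision operator that cones the subdivided boundary of each tuple `w` off at the
point `b w`. -/
def subdiv (b : ∀ p, (Fin (p + 1) → K) → K) : ∀ p, TupleChain K p →+ TupleChain K p
  | 0 => AddMonoidHom.id _
  | p + 1 => lift fun w => cone (b p w) p (subdiv b p (boundary K p (of w)))

theorem subdiv_of (b : ∀ p, (Fin (p + 1) → K) → K) {p : ℕ} (w : Fin (p + 1) → K) :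
    subdiv b (p + 1) (of w) = cone (b p w) p (subdiv b p (boundary K p (of w))) :=
  lift_apply_of _ _

theorem boundary_subdiv (b : ∀ p, (Fin (p + 1) → K) → K) {p : ℕ} (c : TupleChain K (p + 1)) :
    boundary K p (subdiv b (p + 1) c) = subdiv b p (boundary K p c) := by
  suffices (boundary K p).comp (subdiv b (p + 1)) = (subdiv b p).comp (boundary K p) from
    DFunLike.congr_fun this c
  induction p with
  | zero =>
    refine lift_ext _ _ fun w => ?_
    rw [AddMonoidHom.comp_apply, AddMonoidHom.comp_apply, subdiv_of, boundary_cone_zero]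
  | succ p ih =>
    refine lift_ext _ _ fun w => ?_
    have h := DFunLike.congr_fun (ih (boundary K (p + 1) (of w))) (boundary K (p + 1) (of w))
    rw [AddMonoidHom.comp_apply, AddMonoidHom.comp_apply, boundary_boundary, map_zero] at h
    rw [AddMonoidHom.comp_apply, AddMonoidHom.comp_apply, subdiv_of, boundary_cone, h, map_zero,
      sub_zero]

/-- The operator depends only on the choice of cone points, so it is natural for any vertex map that
respects this choice. -/
theorem subdiv_push {b : ∀ p, (Fin (p + 1) → K) → K} {b' : ∀ p, (Fin (p + 1) → L) → L}
    {φ : K → L} (hb : ∀ p w, b' p (φ ∘ w) = φ (b p w)) {p : ℕ} (c : TupleChain K p) :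
    subdiv b' p (push φ p c) = push φ p (subdiv b p c) := by
  induction p with
  | zero => rfl
  | succ p ih =>
    suffices (subdiv b' (p + 1)).comp (push φ (p + 1)) = (push φ (p + 1)).comp (subdiv b (p + 1))
      from DFunLike.congr_fun this c
    refine lift_ext _ _ fun w => ?_
    rw [AddMonoidHom.comp_apply, AddMonoidHom.comp_apply, push_of, subdiv_of, subdiv_of,
      push_cone, ← ih, ← boundary_push, push_of, hb]

/-- The chain homotopy from `G` to `F` built inductively by coning off at the points `b w`. -/
def homotopyOp (b : ∀ p, (Fin (p + 1) → K) → L) (F G : ∀ p, TupleChain K p →+ TupleChain L p) :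
    ∀ p, TupleChain K p →+ TupleChain L (p + 1)
  | 0 => 0
  | p + 1 => lift fun w => cone (b p w) (p + 1) (F (p + 1) (of w) - G (p + 1) (of w) -
      homotopyOp b F G p (boundary K p (of w)))

theorem homotopyOp_of (b : ∀ p, (Fin (p + 1) → K) → L)
    (F G : ∀ p, TupleChain K p →+ TupleChain L p) {p : ℕ} (w : Fin (p + 1) → K) :
    homotopyOp b F G (p + 1) (of w) = cone (b p w) (p + 1) (F (p + 1) (of w) - G (p + 1) (of w) -
      homotopyOp b F G p (boundary K p (of w))) :=
  lift_apply_of _ _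

/-- The chain `F - G - H ∂`, with `H` the homotopy one degree lower, is a cycle by induction, and
coning a cycle off at any point fills it. -/
theorem boundary_homotopyOp (b : ∀ p, (Fin (p + 1) → K) → L)
    {F G : ∀ p, TupleChain K p →+ TupleChain L p}
    (hF : ∀ p c, boundary L p (F (p + 1) c) = F p (boundary K p c))
    (hG : ∀ p c, boundary L p (G (p + 1) c) = G p (boundary K p c)) (h0 : F 0 = G 0)
    {p : ℕ} (c : TupleChain K (p + 1)) :
    boundary L (p + 1) (homotopyOp b F G (p + 1) c) =
      F (p + 1) c - G (p + 1) c - homotopyOp b F G p (boundary K p c) := by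
  suffices (boundary L (p + 1)).comp (homotopyOp b F G (p + 1)) =
      F (p + 1) - G (p + 1) - (homotopyOp b F G p).comp (boundary K p) from
    DFunLike.congr_fun this c
  refine lift_ext _ _ fun w => ?_
  have key : boundary L p (F (p + 1) (of w) - G (p + 1) (of w) -
      homotopyOp b F G p (boundary K p (of w))) = 0 := by
    rw [map_sub, map_sub, hF, hG]
    cases p with
    | zero => simp [homotopyOp, h0]
    | succ p =>
      have := boundary_homotopyOp b hF hG h0 (boundary K (p + 1) (of w))
      rw [this, boundary_boundary, map_zero, sub_zero, sub_self]
  simp only [AddMonoidHom.comp_apply, AddMonoidHom.sub_apply]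
  rw [homotopyOp_of, boundary_cone, key, map_zero, sub_zero]
termination_by p

theorem homotopyOp_push {b : ∀ p, (Fin (p + 1) → K) → L} {b' : ∀ p, (Fin (p + 1) → K') → L'}
    {F G : ∀ p, TupleChain K p →+ TupleChain L p} {F' G' : ∀ p, TupleChain K' p →+ TupleChain L' p}
    {φ : K → K'} {ψ : L → L'} (hb : ∀ p w, b' p (φ ∘ w) = ψ (b p w))
    (hF : ∀ p c, F' p (push φ p c) = push ψ p (F p c))
    (hG : ∀ p c, G' p (push φ p c) = push ψ p (G p c)) {p : ℕ} (c : TupleChain K p) :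
    homotopyOp b' F' G' p (push φ p c) = push ψ (p + 1) (homotopyOp b F G p c) := by
  induction p with
  | zero => simp [homotopyOp]
  | succ p ih =>
    suffices (homotopyOp b' F' G' (p + 1)).comp (push φ (p + 1)) =
      (push ψ (p + 2)).comp (homotopyOp b F G (p + 1)) from DFunLike.congr_fun this c
    refine lift_ext _ _ fun w => ?_
    rw [AddMonoidHom.comp_apply, AddMonoidHom.comp_apply, push_of, homotopyOp_of, homotopyOp_of,
      push_cone, (push ψ (p + 1)).map_sub, (push ψ (p + 1)).map_sub, ← ih, ← boundary_push, ← hF,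
      ← hG, push_of, hb]

end TupleChain

open FreeAbelianGroup TupleChain

/-! ### Evaluation of singular cochains on ordered chains. -/

section Pairing

variable {K : Type*} {Y : Type u} [TopologicalSpace Y] {A : Type v} [AddCommGroup A]

/-- The value of a singular cochain on an ordered chain whose tuples are realized as singular
simplices by `r`. -/
def evalChain {p : ℕ} (r : (Fin (p + 1) → K) → Simplex Y p) (f : Simplex Y p → A) :
    TupleChain K (p + 1) →+ A :=
  lift fun w => f (r w)

theorem evalChain_of {p : ℕ} (r : (Fin (p + 1) → K) → Simplex Y p) (f : Simplex Y p → A)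
    (w : Fin (p + 1) → K) : evalChain r f (of w) = f (r w) :=
  lift_apply_of _ _

theorem evalChain_boundary {p : ℕ} {r : (Fin (p + 1) → K) → Simplex Y p}
    {r' : (Fin (p + 2) → K) → Simplex Y (p + 1)}
    (hr : ∀ (i : Fin (p + 2)) w, r (w ∘ i.succAbove) = (r' w).pull i.succAbove)
    (f : Simplex Y p → A) (c : TupleChain K (p + 2)) :
    evalChain r f (boundary K (p + 1) c) = evalChain r' (coboundary Y A p f) c := by
  suffices (evalChain r f).comp (boundary K (p + 1)) = evalChain r' (coboundary Y A p f) from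
    DFunLike.congr_fun this c
  refine lift_ext _ _ fun w => ?_
  simp [boundary_of, evalChain_of, coboundary_apply, map_sum, map_zsmul, hr]

theorem evalChain_push {L : Type*} {p : ℕ} (r : (Fin (p + 1) → L) → Simplex Y p) (φ : K → L)
    (f : Simplex Y p → A) (c : TupleChain K (p + 1)) :
    evalChain r f (push φ (p + 1) c) = evalChain (fun w => r (φ ∘ w)) f c := by
  suffices (evalChain r f).comp (push φ (p + 1)) = evalChain (fun w => r (φ ∘ w)) f from
    DFunLike.congr_fun this c
  refine lift_ext _ _ fun w => ?_
  simp [push_of, evalChain_of]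

theorem evalChain_eq_zero {p : ℕ} {r : (Fin (p + 1) → K) → Simplex Y p} {f : Simplex Y p → A}
    (h : ∀ w, f (r w) = 0) (c : TupleChain K (p + 1)) : evalChain r f c = 0 := by
  suffices evalChain r f = 0 from DFunLike.congr_fun this c
  refine lift_ext _ _ fun w => ?_
  rw [evalChain_of, h, AddMonoidHom.zero_apply]

end Pairing

/-! ### Affine simplices in convex sets. -/

section Affine

variable {E : Type*} [AddCommGroup E] [Module ℝ E] [TopologicalSpace E] [ContinuousAdd E]
  [ContinuousSMul ℝ E] {K : Set E}

/-- The affine simplex with prescribed vertices in a convex set. -/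
def affineSimplex (hK : Convex ℝ K) {p : ℕ} (w : Fin (p + 1) → K) : Simplex K p :=
  ⟨fun t => ⟨∑ i, t.1 i • (w i : E),
      hK.sum_mem (fun i _ => t.2.1 i) t.2.2 fun i _ => (w i).2⟩, by
    refine Continuous.subtype_mk (continuous_finsetSum _ fun i _ => ?_) _
    exact ((continuous_apply i).comp continuous_subtype_val).smul continuous_const⟩

theorem affineSimplex_coe (hK : Convex ℝ K) {p : ℕ} (w : Fin (p + 1) → K)
    (t : stdSimplex ℝ (Fin (p + 1))) : (affineSimplex hK w t : E) = ∑ i, t i • (w i : E) :=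
  rfl

theorem affineSimplex_pull (hK : Convex ℝ K) {p q : ℕ} (w : Fin (q + 1) → K)
    (θ : Fin (p + 1) → Fin (q + 1)) : (affineSimplex hK w).pull θ = affineSimplex hK (w ∘ θ) := by
  ext t
  change ((affineSimplex hK w (stdSimplex.map θ t) : K) : E) = _
  simp only [affineSimplex_coe, stdSimplex.map_coe, FunOnFinite.linearMap_apply_apply,
    Finset.sum_smul, Function.comp]
  rw [← Finset.sum_fiberwise Finset.univ θ]
  refine Finset.sum_congr rfl fun j _ => Finset.sum_congr rfl fun i hi => ?_
  rw [(Finset.mem_filter.1 hi).2]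

/-- This makes restriction to affine simplices functorial and barycenters natural; it is Fubini for
the two finite sums. -/
theorem affineSimplex_comp (hK : Convex ℝ K) {p q : ℕ} (w : Fin (q + 1) → K)
    (u : Fin (p + 1) → stdSimplex ℝ (Fin (q + 1))) :
    affineSimplex hK (affineSimplex hK w ∘ u) =
      (affineSimplex hK w).comp (affineSimplex (convex_stdSimplex ℝ _) u) := by
  ext t
  change _ = ((affineSimplex hK w (affineSimplex (convex_stdSimplex ℝ _) u t) : K) : E)
  simp only [affineSimplex_coe, Function.comp]
  have (i : Fin (q + 1)) : (affineSimplex (convex_stdSimplex ℝ _) u t) i =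
      ∑ j, t j * u j i :=
    Finset.sum_apply i Finset.univ fun j => t.1 j • (u j).1
  simp only [this, Finset.smul_sum, Finset.sum_smul, smul_smul]
  exact Finset.sum_comm

theorem affineSimplex_comp_vertex (hK : Convex ℝ K) {p : ℕ} (w : Fin (p + 1) → K) :
    affineSimplex hK w ∘ stdSimplex.vertex = w := by
  funext i
  refine Subtype.ext ((affineSimplex_coe hK w _).trans ?_)
  simp [Pi.single_apply]

theorem affineSimplex_vertex (p : ℕ) :
    affineSimplex (convex_stdSimplex ℝ (Fin (p + 1))) stdSimplex.vertex =
      ContinuousMap.id _ := by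
  ext t i
  refine (Finset.sum_apply i Finset.univ fun j => t.1 j • (Pi.single j 1 : Fin (p + 1) → ℝ)).trans ?_
  simp [Pi.single_apply]
  rfl

end Affine

/-! ### Singular simplices restricted to affine simplices. -/

section Linear

variable {Y : Type u} [TopologicalSpace Y] {A : Type v} [AddCommGroup A]

/-- The restriction of a singular `n`-simplex to the affine simplex spanned by a tuple of points
of the standard simplex. -/
def Simplex.restrict {n p : ℕ} (σ : Simplex Y n) (w : Fin (p + 1) → stdSimplex ℝ (Fin (n + 1))) :
    Simplex Y p :=
  σ.comp (affineSimplex (convex_stdSimplex ℝ _) w)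

theorem Simplex.restrict_comp {n p : ℕ} (σ : Simplex Y n)
    (w : Fin (p + 1) → stdSimplex ℝ (Fin (n + 1))) {q : ℕ} (θ : Fin (q + 1) → Fin (p + 1)) :
    σ.restrict (w ∘ θ) = (σ.restrict w).pull θ := by
  rw [restrict, ← affineSimplex_pull]
  rfl

theorem Simplex.restrict_vertex {n : ℕ} (σ : Simplex Y n) :
    σ.restrict stdSimplex.vertex = σ := by
  rw [restrict, affineSimplex_vertex]
  rfl

theorem Simplex.restrict_restrict {n p q : ℕ} (σ : Simplex Y n)
    (w : Fin (p + 1) → stdSimplex ℝ (Fin (n + 1)))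
    (u : Fin (q + 1) → stdSimplex ℝ (Fin (p + 1))) :
    (σ.restrict w).restrict u = σ.restrict (affineSimplex (convex_stdSimplex ℝ _) w ∘ u) := by
  simp only [restrict, affineSimplex_comp]
  rfl

theorem evalChain_restrict_boundary {n p : ℕ} (σ : Simplex Y n) (f : Simplex Y p → A)
    (c : TupleChain (stdSimplex ℝ (Fin (n + 1))) (p + 2)) :
    evalChain σ.restrict f (boundary _ (p + 1) c) =
      evalChain σ.restrict (coboundary Y A p f) c :=
  evalChain_boundary (fun i w => σ.restrict_comp w i.succAbove) f c

theorem evalChain_restrict_push {n p q : ℕ} (σ : Simplex Y n)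
    (w : Fin (p + 1) → stdSimplex ℝ (Fin (n + 1))) (f : Simplex Y q → A)
    (c : TupleChain (stdSimplex ℝ (Fin (p + 1))) (q + 1)) :
    evalChain σ.restrict f (push (affineSimplex (convex_stdSimplex ℝ _) w) (q + 1) c) =
      evalChain (σ.restrict w).restrict f c := by
  rw [evalChain_push]
  simp only [← Simplex.restrict_restrict]

/-- A simplex is its own restriction to the vertex tuple, so the identity is dual to
`boundary_boundary`. -/
theorem coboundary_coboundary {n : ℕ} (f : Simplex Y n → A) :
    coboundary Y A (n + 1) (coboundary Y A n f) = 0 := by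
  funext σ
  rw [← σ.restrict_vertex, ← evalChain_of σ.restrict (coboundary Y A (n + 1) _),
    ← evalChain_restrict_boundary, ← evalChain_restrict_boundary, boundary_boundary, map_zero, Pi.zero_apply]

theorem coboundaries_le_cocycles (B : Set Y) (A : Type v) [AddCommGroup A] (n : ℕ) :
    coboundaries B A n ≤ cocycles B A n := by
  cases n with
  | zero => exact bot_le
  | succ n =>
    rintro _ ⟨g, hg, rfl⟩
    refine ⟨fun σ hσ => ?_, AddMonoidHom.mem_ker.2 (coboundary_coboundary g)⟩
    rw [coboundary_apply]
    exact Finset.sum_eq_zero fun i _ => by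
      rw [hg _ (Simplex.pull_mem _ hσ), smul_zero]

end Linear

/-! ### Mesh of iterated barycentric subdivisions. -/

section Mesh

variable {E : Type*} [NormedAddCommGroup E] [NormedSpace ℝ E] {K : Set E}

/-- The barycenter of the affine simplex spanned by a tuple. -/
def tupleBarycenter (hK : Convex ℝ K) (p : ℕ) (w : Fin (p + 1) → K) : K :=
  affineSimplex hK w stdSimplex.barycenter

theorem tupleBarycenter_coe (hK : Convex ℝ K) {p : ℕ} (w : Fin (p + 1) → K) :
    (tupleBarycenter hK p w : E) = ∑ i, ((p : ℝ) + 1)⁻¹ • (w i : E) := by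
  rw [tupleBarycenter, affineSimplex_coe]
  refine Finset.sum_congr rfl fun i _ => ?_
  congr 1
  refine (stdSimplex.barycenter_apply (𝕜 := ℝ) i).trans ?_
  simp

theorem dist_tupleBarycenter_le (hK : Convex ℝ K) {p : ℕ} {w : Fin (p + 1) → K} {d : ℝ}
    (hd : ∀ i j, dist (w i) (w j) ≤ d) (i : Fin (p + 1)) :
    dist (w i) (tupleBarycenter hK p w) ≤ p / (p + 1) * d := by
  have hp : (0 : ℝ) < p + 1 := by positivity
  have e : (w i : E) - tupleBarycenter hK p w =
      ∑ j, ((p : ℝ) + 1)⁻¹ • ((w i : E) - w j) := by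
    simp only [smul_sub, Finset.sum_sub_distrib]
    rw [tupleBarycenter_coe, Finset.sum_const, Finset.card_univ, Fintype.card_fin,
      ← Nat.cast_smul_eq_nsmul ℝ, smul_smul]
    push_cast
    rw [mul_inv_cancel₀ hp.ne', one_smul]
  rw [Subtype.dist_eq, dist_eq_norm, e]
  calc ‖∑ j, ((p : ℝ) + 1)⁻¹ • ((w i : E) - w j)‖
      ≤ ∑ j, ‖((p : ℝ) + 1)⁻¹ • ((w i : E) - w j)‖ := norm_sum_le _ _
    -- The term `j = i` vanishes, leaving `p` of the `p + 1` summands; this is the source of the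
    -- contraction factor.
    _ = ∑ j : Fin p, ‖((p : ℝ) + 1)⁻¹ • ((w i : E) - w (i.succAbove j))‖ := by
        rw [Fin.sum_univ_succAbove _ i]
        simp
    _ ≤ ∑ _j : Fin p, ((p : ℝ) + 1)⁻¹ * d := by
        refine Finset.sum_le_sum fun j _ => ?_
        rw [norm_smul, Real.norm_of_nonneg (inv_nonneg.2 hp.le), ← dist_eq_norm, ← Subtype.dist_eq]
        exact mul_le_mul_of_nonneg_left (hd _ _) (inv_nonneg.2 hp.le)
    _ = p / (p + 1) * d := by
        rw [Finset.sum_const, Finset.card_univ, Fintype.card_fin, nsmul_eq_mul]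
        ring

/-- The convex set `S` strengthens the induction: applied to a face with `S` cut down by a ball
around the barycenter, it bounds the distances from the new cone point to the other vertices. -/
theorem subdiv_of_mem_closure (hK : Convex ℝ K) {p : ℕ} {w : Fin p → K} {d : ℝ}
    (hd : ∀ i j, dist (w i) (w j) ≤ d) {S : Set E} (hS : Convex ℝ S) (hw : ∀ i, (w i : E) ∈ S) :
    subdiv (tupleBarycenter hK) p (of w) ∈ AddSubgroup.closure
      (of '' {u : Fin p → K | (∀ i, (u i : E) ∈ S) ∧
        ∀ i j, dist (u i) (u j) ≤ p / (p + 1) * d}) := by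
  induction p generalizing S with
  | zero => exact AddSubgroup.subset_closure ⟨w, ⟨fun i => i.elim0, fun i => i.elim0⟩, rfl⟩
  | succ p ih =>
    have hd0 : 0 ≤ d := dist_nonneg.trans (hd 0 0)
    set b := tupleBarycenter hK p w with hb
    set r : ℝ := p / (p + 1) * d
    -- A tuple of length `p + 1` spans dimension `p`, where the sharp factor is `p / (p + 1)`; the
    -- stated bound is weaker by one index, and `r` is both the radius at the barycenter and the
    -- mesh of the faces.
    have hr' : r ≤ ((p + 1 : ℕ) : ℝ) / ((p + 1 : ℕ) + 1) * d := by
      refine mul_le_mul_of_nonneg_right ?_ hd0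
      push_cast
      rw [div_le_div_iff₀ (by positivity) (by positivity)]
      nlinarith
    have hr0 : 0 ≤ r := by positivity
    have hbS : (b : E) ∈ S := by
      rw [hb, tupleBarycenter, affineSimplex_coe]
      exact hS.sum_mem (fun i _ => stdSimplex.barycenter.2.1 i) stdSimplex.barycenter.2.2
        fun i _ => hw i
    rw [subdiv_of, boundary_of, map_sum, map_sum]
    refine AddSubgroup.sum_mem _ fun i _ => ?_
    rw [map_zsmul, map_zsmul]
    refine AddSubgroup.zsmul_mem _ ?_ _
    rw [← AddSubgroup.mem_comap]
    refine (AddSubgroup.closure_le _).2 ?_ (ih (w := w ∘ i.succAbove) (fun _ _ => hd _ _)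
      (hS.inter (convex_closedBall (b : E) r))
      fun j => ⟨hw _, dist_tupleBarycenter_le hK hd _⟩)
    rintro _ ⟨u, ⟨hu, hu'⟩, rfl⟩
    refine AddSubgroup.subset_closure ⟨_, ⟨fun j => ?_, fun j k => ?_⟩, (cone_of b u).symm⟩
    · cases j using Fin.cases with
      | zero => exact hbS
      | succ j => exact (hu j).1
    · refine le_trans ?_ hr'
      cases j using Fin.cases with
      | zero =>
        cases k using Fin.cases with
        | zero => simpa using hr0
        | succ k =>
          rw [dist_comm]
          exact (hu k).2
      | succ j =>
        cases k using Fin.cases with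
        | zero => exact (hu j).2
        | succ k => exact hu' j k

theorem iterate_subdiv_of_mem_closure (hK : Convex ℝ K) {p : ℕ} {w : Fin p → K} {d : ℝ}
    (hd : ∀ i j, dist (w i) (w j) ≤ d) (m : ℕ) :
    (subdiv (tupleBarycenter hK) p)^[m] (of w) ∈ AddSubgroup.closure
      (of '' {u : Fin p → K | ∀ i j, dist (u i) (u j) ≤ ((p : ℝ) / (p + 1)) ^ m * d}) := by
  induction m with
  | zero => exact AddSubgroup.subset_closure ⟨w, by simpa using hd, rfl⟩
  | succ m ih =>
    rw [Function.iterate_succ_apply', ← AddSubgroup.mem_comap]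
    refine (AddSubgroup.closure_le _).2 ?_ ih
    rintro _ ⟨u, hu, rfl⟩
    refine AddSubgroup.closure_mono (Set.image_mono fun x hx => ?_)
      (subdiv_of_mem_closure hK hu convex_univ fun _ => Set.mem_univ _)
    rw [Set.mem_ofPred_eq, pow_succ', mul_assoc]
    exact hx.2

end Mesh

/-! ### Cocycles that vanish on small simplices. -/

section SmallSimplices

variable {Y : Type u} [TopologicalSpace Y] {A : Type v} [AddCommGroup A]

/-- Barycentric subdivision of ordered chains in the standard simplex. -/
abbrev stdSubdiv (n p : ℕ) : TupleChain (stdSimplex ℝ (Fin (n + 1))) p →+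
    TupleChain (stdSimplex ℝ (Fin (n + 1))) p :=
  subdiv (tupleBarycenter (convex_stdSimplex ℝ _)) p

/-- The chain homotopy from barycentric subdivision to the identity. -/
abbrev stdHomotopy (n p : ℕ) : TupleChain (stdSimplex ℝ (Fin (n + 1))) p →+
    TupleChain (stdSimplex ℝ (Fin (n + 1))) (p + 1) :=
  homotopyOp (tupleBarycenter (convex_stdSimplex ℝ _)) (fun _ => AddMonoidHom.id _)
    (stdSubdiv n) p

theorem boundary_stdHomotopy (n p : ℕ) (c : TupleChain (stdSimplex ℝ (Fin (n + 1))) (p + 1)) :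
    boundary _ (p + 1) (stdHomotopy n (p + 1) c) =
      c - stdSubdiv n (p + 1) c - stdHomotopy n p (boundary _ p c) :=
  boundary_homotopyOp (tupleBarycenter (convex_stdSimplex ℝ (Fin (n + 1))))
    (F := fun _ => AddMonoidHom.id _) (G := stdSubdiv n) (fun _ _ => rfl)
    (fun _ c => boundary_subdiv _ c) rfl c

/-- The chain homotopy from the `m`-th barycentric subdivision to the identity. -/
def iterHomotopy (n p : ℕ) : ℕ → (TupleChain (stdSimplex ℝ (Fin (n + 1))) p →+
    TupleChain (stdSimplex ℝ (Fin (n + 1))) (p + 1))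
  | 0 => 0
  | m + 1 => stdHomotopy n p + (iterHomotopy n p m).comp (stdSubdiv n p)

theorem iterHomotopy_succ (m n p : ℕ) (c : TupleChain (stdSimplex ℝ (Fin (n + 1))) p) :
    iterHomotopy n p (m + 1) c = stdHomotopy n p c + iterHomotopy n p m (stdSubdiv n p c) :=
  rfl

theorem iterHomotopy_apply (m n p : ℕ) (c : TupleChain (stdSimplex ℝ (Fin (n + 1))) p) :
    iterHomotopy n p m c =
      ∑ i ∈ Finset.range m, stdHomotopy n p ((stdSubdiv n p)^[i] c) := by
  induction m generalizing c with
  | zero => rfl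
  | succ m ih =>
    rw [iterHomotopy_succ, ih, Finset.sum_range_succ']
    exact add_comm _ _

/-- Precomposing the one-step homotopy with successive subdivisions gives differences that
telescope. -/
theorem boundary_iterHomotopy (m n p : ℕ)
    (c : TupleChain (stdSimplex ℝ (Fin (n + 1))) (p + 1)) :
    boundary _ (p + 1) (iterHomotopy n (p + 1) m c) =
      c - (stdSubdiv n (p + 1))^[m] c - iterHomotopy n p m (boundary _ p c) := by
  induction m generalizing c with
  | zero =>
    change boundary _ (p + 1) 0 = c - c - 0
    rw [map_zero, sub_self, sub_zero]
  | succ m ih =>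
    rw [iterHomotopy_succ, iterHomotopy_succ, map_add, ih, boundary_stdHomotopy, boundary_subdiv,
      Function.iterate_succ_apply]
    abel

theorem tupleBarycenter_affineSimplex {n q : ℕ} (w : Fin (q + 1) → stdSimplex ℝ (Fin (n + 1)))
    (p : ℕ) (u : Fin (p + 1) → stdSimplex ℝ (Fin (q + 1))) :
    tupleBarycenter (convex_stdSimplex ℝ _) p (affineSimplex (convex_stdSimplex ℝ _) w ∘ u) =
      affineSimplex (convex_stdSimplex ℝ _) w (tupleBarycenter (convex_stdSimplex ℝ _) p u) := by
  rw [tupleBarycenter, affineSimplex_comp]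
  rfl

theorem stdSubdiv_push {n q p : ℕ} (w : Fin (q + 1) → stdSimplex ℝ (Fin (n + 1)))
    (c : TupleChain (stdSimplex ℝ (Fin (q + 1))) p) :
    stdSubdiv n p (push (affineSimplex (convex_stdSimplex ℝ _) w) p c) =
      push (affineSimplex (convex_stdSimplex ℝ _) w) p (stdSubdiv q p c) :=
  subdiv_push (tupleBarycenter_affineSimplex w) c

theorem stdHomotopy_push {n q p : ℕ} (w : Fin (q + 1) → stdSimplex ℝ (Fin (n + 1)))
    (c : TupleChain (stdSimplex ℝ (Fin (q + 1))) p) :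
    stdHomotopy n p (push (affineSimplex (convex_stdSimplex ℝ _) w) p c) =
      push (affineSimplex (convex_stdSimplex ℝ _) w) (p + 1) (stdHomotopy q p c) :=
  homotopyOp_push (tupleBarycenter_affineSimplex w) (fun _ _ => rfl)
    (fun _ c => stdSubdiv_push w c) c

theorem iterHomotopy_push (m : ℕ) {n q p : ℕ} (w : Fin (q + 1) → stdSimplex ℝ (Fin (n + 1)))
    (c : TupleChain (stdSimplex ℝ (Fin (q + 1))) p) :
    iterHomotopy n p m (push (affineSimplex (convex_stdSimplex ℝ _) w) p c) =
      push (affineSimplex (convex_stdSimplex ℝ _) w) (p + 1) (iterHomotopy q p m c) := by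
  have h (i : ℕ) : (stdSubdiv n p)^[i] (push (affineSimplex (convex_stdSimplex ℝ _) w) p c) =
      push (affineSimplex (convex_stdSimplex ℝ _) w) p ((stdSubdiv q p)^[i] c) := by
    induction i with
    | zero => rfl
    | succ i ih => rw [Function.iterate_succ_apply', Function.iterate_succ_apply', ih,
        stdSubdiv_push]
  simp only [iterHomotopy_apply, h, stdHomotopy_push, map_sum]

/-- A singular simplex is small of order `𝒱` if it lies in a member of `𝒱`. -/
def Simplex.IsSmall (𝒱 : Set (Set Y)) {n : ℕ} (σ : Simplex Y n) : Prop :=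
  ∃ V ∈ 𝒱, ∀ t, σ t ∈ V

theorem Simplex.IsSmall.pull {𝒱 : Set (Set Y)} {m n : ℕ} {σ : Simplex Y n} (h : σ.IsSmall 𝒱)
    (θ : Fin (m + 1) → Fin (n + 1)) : (σ.pull θ).IsSmall 𝒱 :=
  let ⟨V, hV, hσ⟩ := h
  ⟨V, hV, fun _ => hσ _⟩

theorem Simplex.IsSmall.restrict {𝒱 : Set (Set Y)} {m n : ℕ} {σ : Simplex Y n}
    (h : σ.IsSmall 𝒱) (w : Fin (m + 1) → stdSimplex ℝ (Fin (n + 1))) :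
    (σ.restrict w).IsSmall 𝒱 :=
  let ⟨V, hV, hσ⟩ := h
  ⟨V, hV, fun _ => hσ _⟩

/-- Sufficiently fine subdivisions of a singular simplex consist of small simplices. -/
theorem exists_iterate_subdiv_mem_closure_small {𝒱 : Set (Set Y)} (ho : ∀ V ∈ 𝒱, IsOpen V)
    (hc : ⋃₀ 𝒱 = Set.univ) {n : ℕ} (σ : Simplex Y n) (p : ℕ) :
    ∃ N, ∀ m ≥ N, ∀ w : Fin (p + 1) → stdSimplex ℝ (Fin (n + 1)),
      (stdSubdiv n (p + 1))^[m] (of w) ∈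
        AddSubgroup.closure (of '' {u | (σ.restrict u).IsSmall 𝒱}) := by
  obtain ⟨δ, hδ, h⟩ := lebesgue_number_lemma_of_metric (c := fun V : 𝒱 => σ ⁻¹' V.1)
    (isCompact_univ (X := stdSimplex ℝ (Fin (n + 1))))
    (fun V => (ho V V.2).preimage σ.continuous) (fun t _ => by
      obtain ⟨V, hV, ht⟩ := Set.mem_sUnion.1 (hc ▸ Set.mem_univ (σ t))
      exact Set.mem_iUnion.2 ⟨⟨V, hV⟩, ht⟩)
  have hlt : ((p + 1 : ℕ) : ℝ) / ((p + 1 : ℕ) + 1) < 1 := by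
    rw [div_lt_one (by positivity)]
    linarith
  set D := Metric.diam (Set.univ : Set (stdSimplex ℝ (Fin (n + 1))))
  have ht := (tendsto_pow_atTop_nhds_zero_of_lt_one (by positivity) hlt).mul_const D
  rw [zero_mul] at ht
  obtain ⟨N, hN⟩ := Filter.eventually_atTop.1 (ht.eventually (gt_mem_nhds hδ))
  refine ⟨N, fun m hm w => ?_⟩
  refine AddSubgroup.closure_mono (Set.image_mono fun u hu => ?_)
    (iterate_subdiv_of_mem_closure _ (d := D) (fun i j => Metric.dist_le_diam_of_mem
      isCompact_univ.isBounded (Set.mem_univ _) (Set.mem_univ _)) m)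
  obtain ⟨V, hV⟩ := h (u 0) (Set.mem_univ _)
  refine ⟨V, V.2, fun t => hV ?_⟩
  -- Vertices within the Lebesgue number of `u 0` lie in a convex ball, hence so does the simplex
  -- they span.
  have := (convex_ball ((u 0 : Fin (n + 1) → ℝ)) δ).sum_mem (fun i _ => t.2.1 i) t.2.2
    (z := fun i => (u i : Fin (n + 1) → ℝ)) fun i _ => (hu i 0).trans_lt (hN m hm)
  exact this

/-- By naturality the homotopy of a tuple stays inside the affine simplex it spans, so small tuples
yield small simplices only. -/
theorem evalChain_stdHomotopy_small {𝒱 : Set (Set Y)} {n p : ℕ} {f : Simplex Y (p + 1) → A}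
    (hf : ∀ σ : Simplex Y (p + 1), σ.IsSmall 𝒱 → f σ = 0) (σ : Simplex Y n)
    {c : TupleChain (stdSimplex ℝ (Fin (n + 1))) (p + 1)}
    (hc : c ∈ AddSubgroup.closure (of '' {u | (σ.restrict u).IsSmall 𝒱})) :
    evalChain σ.restrict f (stdHomotopy n (p + 1) c) = 0 := by
  suffices AddSubgroup.closure (of '' {u | (σ.restrict u).IsSmall 𝒱}) ≤
      ((evalChain σ.restrict f).comp (stdHomotopy n (p + 1))).ker from this hc
  refine (AddSubgroup.closure_le _).2 ?_
  rintro _ ⟨u, hu, rfl⟩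
  have e : (of u : TupleChain (stdSimplex ℝ (Fin (n + 1))) (p + 1)) =
      push (affineSimplex (convex_stdSimplex ℝ _) u) (p + 1) (of stdSimplex.vertex) := by
    rw [push_of, affineSimplex_comp_vertex]
  rw [SetLike.mem_coe, AddMonoidHom.mem_ker, AddMonoidHom.comp_apply, e, stdHomotopy_push,
    evalChain_restrict_push]
  exact evalChain_eq_zero (fun w => hf _ (Simplex.IsSmall.restrict hu w)) _

/-- A cocycle that vanishes on the simplices small of order an open cover is the coboundary of a
cochain that vanishes on these simplices. -/
theorem exists_coboundary_eq_of_small {𝒱 : Set (Set Y)} (ho : ∀ V ∈ 𝒱, IsOpen V)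
    (hc : ⋃₀ 𝒱 = Set.univ) {n : ℕ} {f : Simplex Y (n + 1) → A}
    (hδ : coboundary Y A (n + 1) f = 0)
    (hf : ∀ σ : Simplex Y (n + 1), σ.IsSmall 𝒱 → f σ = 0) :
    ∃ g : Simplex Y n → A, (∀ σ : Simplex Y n, σ.IsSmall 𝒱 → g σ = 0) ∧
      coboundary Y A n g = f := by
  choose N hN using fun τ : Simplex Y n => exists_iterate_subdiv_mem_closure_small ho hc τ n
  -- The number of subdivisions depends on `τ`, but past `N τ` every further summand is evaluated on
  -- small tuples and contributes zero. Hence all faces of one simplex can share an `m`.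
  have hstable (τ : Simplex Y n) {m : ℕ} (hm : N τ ≤ m) :
      evalChain τ.restrict f (iterHomotopy n (n + 1) m (of stdSimplex.vertex)) =
        evalChain τ.restrict f (iterHomotopy n (n + 1) (N τ) (of stdSimplex.vertex)) := by
    simp only [iterHomotopy_apply, map_sum]
    refine (Finset.sum_subset (Finset.range_mono hm) fun i _ hi => ?_).symm
    exact evalChain_stdHomotopy_small hf τ
      (hN τ i (not_lt.1 fun h => hi (Finset.mem_range.2 h)) _)
  refine ⟨fun τ => evalChain τ.restrict f (iterHomotopy n (n + 1) (N τ) (of stdSimplex.vertex)),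
    fun τ hτ => evalChain_eq_zero (fun w => hf _ (hτ.restrict w)) _, ?_⟩
  funext σ
  obtain ⟨N', hN'⟩ := exists_iterate_subdiv_mem_closure_small ho hc σ (n + 1)
  set m := N' + ∑ i : Fin (n + 2), N (σ.pull i.succAbove)
  have h1 (i : Fin (n + 2)) : N (σ.pull i.succAbove) ≤ m :=
    (Finset.single_le_sum (f := fun i : Fin (n + 2) => N (σ.pull i.succAbove))
      (fun _ _ => Nat.zero_le _) (Finset.mem_univ i)).trans (Nat.le_add_left _ _)
  have h2 (i : Fin (n + 2)) : evalChain (σ.pull i.succAbove).restrict f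
      (iterHomotopy n (n + 1) m (of stdSimplex.vertex)) =
      evalChain σ.restrict f
        (iterHomotopy (n + 1) (n + 1) m (of (stdSimplex.vertex ∘ i.succAbove))) := by
    have e : σ.pull i.succAbove = σ.restrict (stdSimplex.vertex ∘ i.succAbove) := by
      rw [Simplex.restrict_comp, Simplex.restrict_vertex]
    rw [e, ← evalChain_restrict_push, ← iterHomotopy_push, push_of,
      affineSimplex_comp_vertex]
  have h3 : evalChain σ.restrict f ((stdSubdiv (n + 1) (n + 2))^[m] (of stdSimplex.vertex)) = 0 := by
    suffices AddSubgroup.closure (of '' {u | (σ.restrict u).IsSmall 𝒱}) ≤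
      (evalChain σ.restrict f).ker from this (hN' m (Nat.le_add_right _ _) _)
    refine (AddSubgroup.closure_le _).2 ?_
    rintro _ ⟨u, hu, rfl⟩
    exact (evalChain_of _ _ _).trans (hf _ hu)
  -- Evaluating `δ f = 0` on the homotopy of the vertex tuple leaves `f σ` equal to `f` on the
  -- homotopy of its boundary, since the subdivided term dies by `h3`.
  have h4 := evalChain_restrict_boundary σ f
    (iterHomotopy (n + 1) (n + 2) m (of stdSimplex.vertex))
  rw [boundary_iterHomotopy, map_sub, map_sub, h3, sub_zero, hδ,
    evalChain_eq_zero (f := 0) (fun _ => rfl), evalChain_of, Simplex.restrict_vertex, sub_eq_zero] at h4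
  rw [coboundary_apply, h4, boundary_of]
  simp only [map_sum, map_zsmul, ← h2, ← hstable _ (h1 _)]

end SmallSimplices

/-! ### The prism operator and deformations into the subspace. -/

section Prism

variable {Z : Type*} [TopologicalSpace Z] {Y : Type u} [TopologicalSpace Y]
  {A : Type v} [AddCommGroup A]

/-- The prism operator `K → K × [0, 1]`, a chain homotopy between the inclusions of the ends. -/
def prism (K : Type*) (p : ℕ) : TupleChain K p →+ TupleChain (K × unitInterval) (p + 1) :=
  homotopyOp (fun _ w => (w 0, 0)) (fun p => push (fun a => (a, 1)) p)
    (fun p => push (fun a => (a, 0)) p) p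

theorem boundary_prism {K : Type*} {p : ℕ} (c : TupleChain K (p + 1)) :
    boundary _ (p + 1) (prism K (p + 1) c) =
      push (fun a => (a, 1)) (p + 1) c - push (fun a => (a, 0)) (p + 1) c -
        prism K p (boundary K p c) := by
  refine boundary_homotopyOp _ (fun _ c => boundary_push _ c) (fun _ c => boundary_push _ c) ?_ c
  refine lift_ext _ _ fun w => ?_
  rw [push_of, push_of]
  exact congrArg of (Subsingleton.elim _ _)

/-- The cone point `(w 0, 0)` uses no structure on `K`, so naturality holds for arbitrary maps of
vertices. -/
theorem prism_push {K L : Type*} (φ : K → L) {p : ℕ} (c : TupleChain K p) :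
    prism L p (push φ p c) = push (Prod.map φ id) (p + 1) (prism K p c) := by
  refine homotopyOp_push (fun _ _ => rfl) (fun p c => ?_) (fun p c => ?_) c <;>
  · induction c using FreeAbelianGroup.induction_on with
    | zero => simp
    | of w => simp only [push_of]; rfl
    | neg w h => rw [map_neg, map_neg, map_neg, map_neg, h]
    | add x y hx hy => rw [map_add, map_add, map_add, map_add, hx, hy]

/-- The singular simplex `h ∘ (σ × id)` restricted to the affine simplex in the prism spanned by
the tuple `w`. -/
def prismSimplex (h : C(Z × unitInterval, Y)) {n p : ℕ} (σ : Simplex Z n)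
    (w : Fin (p + 1) → stdSimplex ℝ (Fin (n + 1)) × unitInterval) : Simplex Y p :=
  h.comp ((σ.restrict (Prod.fst ∘ w)).prodMk (affineSimplex (convex_Icc 0 1) (Prod.snd ∘ w)))

theorem prismSimplex_apply (h : C(Z × unitInterval, Y)) {n p : ℕ} (σ : Simplex Z n)
    (w : Fin (p + 1) → stdSimplex ℝ (Fin (n + 1)) × unitInterval) (t) :
    prismSimplex h σ w t = h (σ.restrict (Prod.fst ∘ w) t,
      affineSimplex (convex_Icc 0 1) (Prod.snd ∘ w) t) :=
  rfl

theorem prismSimplex_comp (h : C(Z × unitInterval, Y)) {n p q : ℕ} (σ : Simplex Z n)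
    (w : Fin (p + 1) → stdSimplex ℝ (Fin (n + 1)) × unitInterval)
    (θ : Fin (q + 1) → Fin (p + 1)) : prismSimplex h σ (w ∘ θ) = (prismSimplex h σ w).pull θ := by
  rw [prismSimplex, ← Function.comp_assoc, ← Function.comp_assoc, Simplex.restrict_comp,
    ← affineSimplex_pull]
  rfl

theorem prismSimplex_restrict (h : C(Z × unitInterval, Y)) {n p q : ℕ} (σ : Simplex Z n)
    (u : Fin (q + 1) → stdSimplex ℝ (Fin (n + 1)))
    (w : Fin (p + 1) → stdSimplex ℝ (Fin (q + 1)) × unitInterval) :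
    prismSimplex h (σ.restrict u) w =
      prismSimplex h σ (Prod.map (affineSimplex (convex_stdSimplex ℝ _) u) id ∘ w) := by
  rw [prismSimplex, Simplex.restrict_restrict]
  rfl

theorem prismSimplex_const (h : C(Z × unitInterval, Y)) {n : ℕ} (σ : Simplex Z n)
    (ε : unitInterval) (t : stdSimplex ℝ (Fin (n + 1))) :
    prismSimplex h σ ((fun a => (a, ε)) ∘ stdSimplex.vertex) t = h (σ t, ε) := by
  have e1 : affineSimplex (convex_Icc (0 : ℝ) 1) (fun _ : Fin (n + 1) => ε) t = ε := by
    refine Subtype.ext ?_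
    rw [affineSimplex_coe, ← Finset.sum_smul, stdSimplex.sum_eq_one, one_smul]
  have e2 : σ.restrict (Prod.fst ∘ (fun a => (a, ε)) ∘ stdSimplex.vertex) = σ :=
    σ.restrict_vertex
  rw [prismSimplex_apply, e2]
  exact congrArg (fun s => h (σ t, s)) e1

/-- The cochain homotopy formula for the prism operator, evaluated on a cocycle. -/
theorem evalChain_prism_boundary (h : C(Z × unitInterval, Y)) {n : ℕ} {f : Simplex Y n → A}
    (hf : coboundary Y A n f = 0) (σ : Simplex Z n) :
    evalChain (prismSimplex h σ) f (prism _ n (boundary _ n (of stdSimplex.vertex))) =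
      f (prismSimplex h σ ((fun a => (a, 1)) ∘ stdSimplex.vertex)) -
        f (prismSimplex h σ ((fun a => (a, 0)) ∘ stdSimplex.vertex)) := by
  have h1 := evalChain_boundary (r := prismSimplex h σ) (r' := prismSimplex h σ)
    (fun i w => prismSimplex_comp h σ w i.succAbove) f (prism _ (n + 1) (of stdSimplex.vertex))
  rw [boundary_prism, hf, evalChain_eq_zero (f := 0) (fun _ => rfl), map_sub, map_sub, push_of,
    push_of, evalChain_of, evalChain_of, sub_eq_zero] at h1
  exact h1.symm

/-- If `V` can be deformed in `Y` into `B`, keeping `B` inside `B`, then every relative cocycle of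
`(Y, B)` agrees on `V` with a relative coboundary. -/
theorem exists_mem_coboundaries_eq_on {B V : Set Y} (h : C(V × unitInterval, Y))
    (h0 : ∀ v : V, h (v, 0) = v) (h1 : ∀ v : V, h (v, 1) ∈ B)
    (hB : ∀ v : V, (v : Y) ∈ B → ∀ t, h (v, t) ∈ B) {n : ℕ} {f : Simplex Y n → A}
    (hf : f ∈ cocycles B A n) :
    ∃ g ∈ coboundaries B A n, ∀ σ : Simplex Y n, (∀ t, σ t ∈ V) → f σ = g σ := by
  let lift {n : ℕ} (σ : Simplex Y n) (hσ : ∀ t, σ t ∈ V) : Simplex V n :=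
    ⟨fun t => ⟨σ t, hσ t⟩, σ.continuous.subtype_mk hσ⟩
  -- The far end of the prism lies in `B`, where `f` vanishes; only the near end, which is `σ`,
  -- survives.
  have key (σ : Simplex Y n) (hσ : ∀ t, σ t ∈ V) : f σ = - evalChain (prismSimplex h (lift σ hσ)) f
      (prism _ n (boundary _ n (of stdSimplex.vertex))) := by
    have hz : f (prismSimplex h (lift σ hσ) ((fun a => (a, 1)) ∘ stdSimplex.vertex)) = 0 :=
      hf.1 _ fun t => by
        rw [prismSimplex_const]
        exact h1 _
    rw [evalChain_prism_boundary h (AddMonoidHom.mem_ker.1 hf.2), hz, zero_sub, neg_neg]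
    congr 1
    ext t
    rw [prismSimplex_const, h0]
    rfl
  cases n with
  | zero =>
    -- The prism operator is zero on the augmentation term, so in degree `0` the cocycle itself
    -- vanishes on `V`.
    refine ⟨0, zero_mem _, fun σ hσ => ?_⟩
    rw [key σ hσ]
    simp [prism, homotopyOp]
  | succ n =>
    classical
    -- Extension by zero off `V` is harmless: agreement is only needed on simplices in `V`, whose
    -- faces are in `V`. The deformation preserving `B` makes `g` a relative cochain.
    let g (τ : Simplex Y n) : A := if hτ : ∀ t, τ t ∈ V then
      - evalChain (prismSimplex h (lift τ hτ)) f (prism _ (n + 1) (of stdSimplex.vertex)) else 0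
    refine ⟨coboundary Y A n g, ⟨g, fun τ hτB => ?_, rfl⟩, fun σ hσ => ?_⟩
    · by_cases hτ : ∀ t, τ t ∈ V
      · have : evalChain (prismSimplex h (lift τ hτ)) f
            (prism _ (n + 1) (of stdSimplex.vertex)) = 0 :=
          evalChain_eq_zero (fun w => hf.1 _ fun t => hB _ (hτB _) _) _
        simp only [g, dif_pos hτ, this, neg_zero]
      · exact dif_neg hτ
    · rw [key σ hσ, coboundary_apply, boundary_of]
      simp only [map_sum, map_zsmul, ← Finset.sum_neg_distrib, ← smul_neg]
      refine Finset.sum_congr rfl fun i _ => ?_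
      have hi : ∀ t, σ.pull i.succAbove t ∈ V := Simplex.pull_mem _ hσ
      have e : lift (σ.pull i.succAbove) hi =
          (lift σ hσ).restrict (stdSimplex.vertex ∘ i.succAbove) := by
        rw [Simplex.restrict_comp, Simplex.restrict_vertex]
        rfl
      have e2 : (of (stdSimplex.vertex ∘ i.succAbove) :
          TupleChain (stdSimplex ℝ (Fin (n + 2))) (n + 1)) =
          push (affineSimplex (convex_stdSimplex ℝ _) (stdSimplex.vertex ∘ i.succAbove)) (n + 1)
            (of stdSimplex.vertex) := by
        rw [push_of, affineSimplex_comp_vertex]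
      simp only [g, dif_pos hi, e]
      rw [e2, prism_push, evalChain_push]
      simp only [← prismSimplex_restrict]

end Prism

/-! ### Classes represented by cocycles vanishing on small simplices. -/

section SmallClasses

universe v₁ v₂ v₃

variable {Y : Type u} [TopologicalSpace Y]

/-- The graded subgroup of `H^*(Y, B; A)` generated by the classes of the relative cocycles that
vanish on all `𝒱`-small simplices. -/
def smallClasses (B : Set Y) (𝒱 : Set (Set Y)) (A : Type v) [AddCommGroup A] :
    AddSubgroup (Htot B A) :=
  AddSubgroup.closure {x | ∃ (n : ℕ) (f : cocycles B A n),
    (∀ σ : Simplex Y n, σ.IsSmall 𝒱 → f.1 σ = 0) ∧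
      DirectSum.of (fun n => H B A n) n (QuotientAddGroup.mk f) = x}

theorem coeffMap_mem_smallClasses {A : Type v} [AddCommGroup A] {A' : Type w} [AddCommGroup A']
    {B : Set Y} {𝒱 : Set (Set Y)} (φ : A →+ A') {x : Htot B A} (hx : x ∈ smallClasses B 𝒱 A) :
    coeffMap B φ x ∈ smallClasses B 𝒱 A' := by
  rw [← AddSubgroup.mem_comap]
  refine (AddSubgroup.closure_le _).2 ?_ hx
  rintro _ ⟨n, f, hf, rfl⟩
  refine AddSubgroup.subset_closure ⟨n, coeffCocycles B φ n f, fun σ hσ => ?_, ?_⟩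
  · exact (congrArg φ (hf σ hσ)).trans (map_zero φ)
  · exact (DirectSum.map_of (fun n => coeffH B φ n) n (QuotientAddGroup.mk f)).symm

theorem cup_of_of {A₁ : Type v₁} {A₂ : Type v₂} {A₃ : Type v₃} [AddCommGroup A₁] [AddCommGroup A₂]
    [AddCommGroup A₃] (B : Set Y) (μ : A₁ →+ A₂ →+ A₃) {p q : ℕ} (f : cocycles B A₁ p)
    (g : cocycles B A₂ q) :
    cup B μ (DirectSum.of (fun n => H B A₁ n) p (QuotientAddGroup.mk f))
      (DirectSum.of (fun n => H B A₂ n) q (QuotientAddGroup.mk g)) =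
        DirectSum.of (fun n => H B A₃ n) (p + q) (QuotientAddGroup.mk (cupCocycles B μ p q f g)) := by
  simp only [cup, DirectSum.toAddMonoid_of, AddMonoidHom.flip_apply]
  rfl

/-- Both faces of a simplex lying in `V` lie in `V`, so one of the two factors is zero already at
cochain level. -/
theorem cup_mem_smallClasses {A₁ : Type v₁} {A₂ : Type v₂} {A₃ : Type v₃} [AddCommGroup A₁]
    [AddCommGroup A₂] [AddCommGroup A₃] {B : Set Y} {𝒱 𝒲 : Set (Set Y)} (μ : A₁ →+ A₂ →+ A₃)
    {x : Htot B A₁} {y : Htot B A₂} (hx : x ∈ smallClasses B 𝒱 A₁)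
    (hy : y ∈ smallClasses B 𝒲 A₂) : cup B μ x y ∈ smallClasses B (𝒱 ∪ 𝒲) A₃ := by
  change x ∈ (smallClasses B (𝒱 ∪ 𝒲) A₃).comap ((cup B μ).flip y)
  refine (AddSubgroup.closure_le _).2 ?_ hx
  rintro _ ⟨p, f, hf, rfl⟩
  rw [SetLike.mem_coe, AddSubgroup.mem_comap, AddMonoidHom.flip_apply, ← AddSubgroup.mem_comap]
  refine (AddSubgroup.closure_le _).2 ?_ hy
  rintro _ ⟨q, g, hg, rfl⟩
  rw [SetLike.mem_coe, AddSubgroup.mem_comap, cup_of_of]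
  refine AddSubgroup.subset_closure ⟨p + q, cupCocycles B μ p q f g, fun σ hσ => ?_, rfl⟩
  change μ (f.1 (σ.pull (frontIdx rfl))) (g.1 (σ.pull (backIdx rfl))) = 0
  obtain ⟨V, hV | hV, hσ⟩ := hσ
  · rw [hf _ (Simplex.IsSmall.pull ⟨V, hV, hσ⟩ _), map_zero, AddMonoidHom.zero_apply]
  · rw [hg _ (Simplex.IsSmall.pull ⟨V, hV, hσ⟩ _), map_zero]

theorem cupTensor_mem_smallClasses {B : Set Y} {n : ℕ} {A : Fin (n + 1) → Type v}
    [∀ i, AddCommGroup (A i)] (V : Fin (n + 1) → Set Y) {x : ∀ i, Htot B (A i)}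
    (hx : ∀ i, x i ∈ smallClasses B {V i} (A i)) :
    cupTensor B n A x ∈ smallClasses B (Set.range V) (⨂[ℤ] i, A i) := by
  induction n with
  | zero =>
    have e : Set.range V = {V 0} := by
      ext W
      simp [eq_comm]
    rw [e]
    exact coeffMap_mem_smallClasses _ (hx 0)
  | succ n ih =>
    have e : Set.range V = {V 0} ∪ Set.range fun i : Fin (n + 1) => V i.succ := by
      ext W
      simp [Fin.exists_fin_succ, eq_comm]
    rw [e]
    exact cup_mem_smallClasses _ (hx 0) (ih (fun i => V i.succ) fun i => hx i.succ)

/-- Small classes of an open cover by sets one of which contains `B` vanish. -/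
theorem smallClasses_eq_bot {A : Type v} [AddCommGroup A] {B : Set Y} {𝒱 : Set (Set Y)}
    (ho : ∀ V ∈ 𝒱, IsOpen V) (hc : ⋃₀ 𝒱 = Set.univ) (hB : ∃ V ∈ 𝒱, B ⊆ V) :
    smallClasses B 𝒱 A = ⊥ := by
  refine AddSubgroup.closure_eq_bot_iff.2 ?_
  rintro _ ⟨n, f, hf, rfl⟩
  rw [Set.mem_singleton_iff]
  suffices (QuotientAddGroup.mk f : H B A n) = 0 by rw [this, map_zero]
  refine (QuotientAddGroup.eq_zero_iff _).2 (AddSubgroup.mem_addSubgroupOf.2 ?_)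
  cases n with
  | zero =>
    -- A `0`-simplex is a point, hence always small, and there are no nonzero coboundaries in degree
    -- `0`.
    change f.1 = 0
    funext σ
    obtain ⟨V, hV, hσ⟩ := Set.mem_sUnion.1 (hc ▸ Set.mem_univ (σ default))
    exact hf σ ⟨V, hV, fun t => by rwa [Subsingleton.elim t default]⟩
  | succ n =>
    obtain ⟨g, hg, hgf⟩ := exists_coboundary_eq_of_small ho hc (AddMonoidHom.mem_ker.1 f.2.2) hf
    obtain ⟨V, hV, hBV⟩ := hB
    exact ⟨g, fun σ hσ => hg σ ⟨V, hV, fun t => hBV (hσ t)⟩, hgf⟩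

/-- If `V` can be deformed in `Y` into `B`, keeping `B` inside `B`, then every class of `(Y, B)` is
represented by cocycles that vanish on `V`. -/
theorem smallClasses_eq_top {A : Type v} [AddCommGroup A] {B V : Set Y}
    (h : C(V × unitInterval, Y)) (h0 : ∀ v : V, h (v, 0) = v) (h1 : ∀ v : V, h (v, 1) ∈ B)
    (hB : ∀ v : V, (v : Y) ∈ B → ∀ t, h (v, t) ∈ B) : smallClasses B {V} A = ⊤ := by
  refine eq_top_iff.2 fun x _ => ?_
  induction x using DirectSum.induction_on with
  | zero => exact zero_mem _
  | add x y hx hy => exact add_mem (hx trivial) (hy trivial)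
  | of n x =>
    obtain ⟨f, rfl⟩ := QuotientAddGroup.mk_surjective x
    obtain ⟨g, hg, hfg⟩ := exists_mem_coboundaries_eq_on h h0 h1 hB f.2
    have hle := coboundaries_le_cocycles B A n
    refine AddSubgroup.subset_closure ⟨n, f - ⟨g, hle hg⟩, ?_, ?_⟩
    · rintro σ ⟨_, rfl, hσ⟩
      exact sub_eq_zero.2 (hfg σ hσ)
    · congr 1
      refine QuotientAddGroup.eq.2 (AddSubgroup.mem_addSubgroupOf.2 ?_)
      have : -(f - ⟨g, hle hg⟩) + f = ⟨g, hle hg⟩ := by abel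
      rw [this]
      exact hg

end SmallClasses

end

end RelSing

/-! ### Deformations of the symmetric square from motion planners. -/

section SymmSquare

variable {X : Type u} [TopologicalSpace X]

theorem SymmSquare.isOpenQuotientMap_mk :
    IsOpenQuotientMap (fun p : X × X => (Sym2.mk p.1 p.2 : SymmSquare X)) := by
  have hq : Topology.IsQuotientMap (fun p : X × X => (Sym2.mk p.1 p.2 : SymmSquare X)) :=
    isQuotientMap_quot_mk
  refine ⟨hq.surjective, hq.continuous, fun U hU => ?_⟩
  rw [← hq.isOpen_preimage]
  have : (fun p : X × X => (Sym2.mk p.1 p.2 : SymmSquare X)) ⁻¹'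
      ((fun p : X × X => (Sym2.mk p.1 p.2 : SymmSquare X)) '' U) = U ∪ Prod.swap ⁻¹' U := by
    ext ⟨x, y⟩
    simp only [Set.mem_preimage, Set.mem_image, Prod.exists, Sym2.eq_iff, Set.mem_union,
      Prod.swap_prod_mk]
    constructor
    · rintro ⟨a, b, hab, ⟨rfl, rfl⟩ | ⟨rfl, rfl⟩⟩
      exacts [Or.inl hab, Or.inr hab]
    · rintro (h | h)
      exacts [⟨x, y, h, Or.inl ⟨rfl, rfl⟩⟩, ⟨y, x, h, Or.inr ⟨rfl, rfl⟩⟩]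
  rw [this]
  exact hU.union (hU.preimage continuous_swap)

/-- An equivariant motion planner on `U` that is constant on the diagonal deforms the image of `U`
in the symmetric square into the diagonal, relative to the diagonal. -/
theorem IsMonoidalSymmetricDomain.exists_deformation {U : Set (X × X)}
    (hU : IsMonoidalSymmetricDomain U) :
    ∃ h : C((fun p : X × X => (Sym2.mk p.1 p.2 : SymmSquare X)) '' U × unitInterval, SymmSquare X),
      (∀ v, h (v, 0) = v) ∧ (∀ v, h (v, 1) ∈ SymmSquare.diagonal X) ∧
        ∀ v : (fun p : X × X => (Sym2.mk p.1 p.2 : SymmSquare X)) '' U,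
          (v : SymmSquare X) ∈ SymmSquare.diagonal X → ∀ t, h (v, t) ∈ SymmSquare.diagonal X := by
  obtain ⟨s, hs, hswap, hdiag⟩ := hU.exists_section
  set π : X × X → SymmSquare X := fun p => Sym2.mk p.1 p.2
  have hπo : IsOpenQuotientMap π := SymmSquare.isOpenQuotientMap_mk
  let q : U → π '' U := fun p => ⟨π p, p, p.2, rfl⟩
  -- Openness matters: open quotient maps stay quotient maps after a product with the interval, so
  -- the homotopy descends.
  have hq : IsOpenQuotientMap q := by
    refine ⟨?_, ?_, fun W hW => ?_⟩
    · rintro ⟨_, p, hp, rfl⟩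
      exact ⟨⟨p, hp⟩, rfl⟩
    · exact (hπo.continuous.comp continuous_subtype_val).subtype_mk _
    · refine ⟨π '' (Subtype.val '' W), hπo.isOpenMap _ (hU.isOpen.isOpenMap_subtype_val _ hW), ?_⟩
      ext v
      constructor
      · rintro ⟨_, ⟨w, hw, rfl⟩, e⟩
        exact ⟨w, hw, Subtype.ext e⟩
      · rintro ⟨w, hw, e⟩
        exact ⟨w, ⟨w, hw, rfl⟩, congrArg Subtype.val e⟩
  have half_mem (t : unitInterval) : (t : ℝ) / 2 ∈ unitInterval :=
    ⟨by linarith [t.2.1], by linarith [t.2.2]⟩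
  let half : C(unitInterval, unitInterval) :=
    ⟨fun t => ⟨t / 2, half_mem t⟩, (continuous_subtype_val.div_const 2).subtype_mk half_mem⟩
  have hs₁ : Continuous fun z : U × unitInterval => s z.1 (half z.2) := by fun_prop
  have hs₂ : Continuous fun z : U × unitInterval => s z.1 (unitInterval.symm (half z.2)) := by
    fun_prop
  -- Both ends of the path travel towards its midpoint.
  let F : C(U × unitInterval, SymmSquare X) :=
    ⟨fun z => π (s z.1 (half z.2), s z.1 (unitInterval.symm (half z.2))),
      hπo.continuous.comp (hs₁.prodMk hs₂)⟩
  have hF : ∀ z z' : U × unitInterval, Prod.map q id z = Prod.map q id z' → F z = F z' := by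
    rintro ⟨⟨⟨x, y⟩, hp⟩, t⟩ ⟨⟨⟨x', y'⟩, hp'⟩, t'⟩ h
    obtain ⟨hq', rfl⟩ : q ⟨(x, y), hp⟩ = q ⟨(x', y'), hp'⟩ ∧ t = t' := Prod.mk.inj h
    have he : π (x, y) = π (x', y') := congrArg Subtype.val hq'
    rcases Sym2.eq_iff.1 he with ⟨h1, h2⟩ | ⟨h1, h2⟩
    · simp only at h1 h2
      subst h1 h2
      rfl
    · simp only at h1 h2
      subst h1 h2
      -- Reversing the path exchanges the two moving points, which the unordered pair ignores.
      have e := hswap ⟨(x, y), hp⟩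
      simp only [Prod.swap_prod_mk] at e
      change π _ = π _
      simp only [e, unitInterval.symm_symm]
      exact Sym2.eq_swap
  have hquot : Topology.IsQuotientMap (Prod.map q (id : unitInterval → unitInterval)) :=
    (hq.prodMap IsOpenQuotientMap.id).isQuotientMap
  let Q : C(U × unitInterval, (π '' U) × unitInterval) := ⟨Prod.map q id, hquot.continuous⟩
  have hQ : Topology.IsQuotientMap Q := hquot
  have hlift (p : U) (t : unitInterval) :
      hQ.lift F (fun z z' h => hF z z' h) (q p, t) = F (p, t) :=
    DFunLike.congr_fun (hQ.lift_comp F fun z z' h => hF z z' h) (p, t)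
  refine ⟨hQ.lift F fun z z' h => hF z z' h, fun v => ?_, fun v => ?_, fun v hv t => ?_⟩
  · obtain ⟨p, rfl⟩ := hq.surjective v
    have e : half 0 = 0 := Subtype.ext (zero_div 2)
    rw [hlift]
    change π (s p (half 0), s p (unitInterval.symm (half 0))) = π p
    rw [e, unitInterval.symm_zero, (hs p).1, (hs p).2]
  · obtain ⟨p, rfl⟩ := hq.surjective v
    have e : unitInterval.symm (half 1) = half 1 :=
      Subtype.ext (by change (1 : ℝ) - 1 / 2 = 1 / 2; norm_num)
    rw [hlift]
    refine ⟨_, ?_, rfl⟩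
    exact congrArg (s p) e.symm
  · obtain ⟨p, rfl⟩ := hq.surjective v
    obtain ⟨⟨x, y⟩, hxy, he⟩ := hv
    obtain rfl : x = y := hxy
    obtain ⟨⟨a, b⟩, hp⟩ := p
    obtain ⟨rfl, rfl⟩ : a = x ∧ b = x := by
      rcases Sym2.eq_iff.1 he with ⟨h1, h2⟩ | ⟨h1, h2⟩
      · exact ⟨h1.symm, h2.symm⟩
      · exact ⟨h2.symm, h1.symm⟩
    rw [hlift]
    exact ⟨_, (hdiag _ _).trans (hdiag _ _).symm, rfl⟩

end SymmSquare

/-! ### The cohomological lower bound. -/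

theorem theorem4p3 {X : Type u} [TopologicalSpace X] (k : ℕ)
    {A : Fin (k + 1) → Type v} [∀ i, AddCommGroup (A i)] {M : Type w} [AddCommGroup M]
    (μ : MultilinearMap ℤ A M)
    (x : ∀ i, RelSing.Htot (SymmSquare.diagonal X) (A i))
    (hx : RelSing.cupProduct (SymmSquare.diagonal X) μ x ≠ 0) :
    ((k + 1 : ℕ) : ℕ∞) ≤ monoidalSymmetrizedTC X := by
  refine le_iInf₂ fun m ⟨U, hU, hc⟩ => ?_
  by_contra hlt
  rw [Nat.cast_le, not_le, Nat.lt_succ_iff] at hlt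
  refine hx ?_
  -- There are `m + 1 ≤ k + 1` planners; truncating the index at `m` repeats the last one, so that
  -- every class gets a set and every set is used.
  let V (i : Fin (k + 1)) : Set (SymmSquare X) :=
    (fun p : X × X => (Sym2.mk p.1 p.2 : SymmSquare X)) ''
      U ⟨min i m, Nat.lt_succ_of_le (min_le_right _ _)⟩
  have hV (i) : x i ∈ RelSing.smallClasses (SymmSquare.diagonal X) {V i} (A i) := by
    obtain ⟨h, h0, h1, hB⟩ := (hU ⟨min i m, Nat.lt_succ_of_le (min_le_right _ _)⟩).exists_deformation
    rw [RelSing.smallClasses_eq_top h h0 h1 hB]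
    trivial
  have hmem : RelSing.cupProduct (SymmSquare.diagonal X) μ x ∈
      RelSing.smallClasses (SymmSquare.diagonal X) (Set.range V) M :=
    RelSing.coeffMap_mem_smallClasses _ (RelSing.cupTensor_mem_smallClasses V hV)
  have hbot : RelSing.smallClasses (SymmSquare.diagonal X) (Set.range V) M = ⊥ := by
    refine RelSing.smallClasses_eq_bot ?_ ?_ ?_
    · rintro _ ⟨i, rfl⟩
      exact SymmSquare.isOpenQuotientMap_mk.isOpenMap _ (hU _).isOpen
    · refine Set.eq_univ_of_forall fun z => ?_
      obtain ⟨p, rfl⟩ := SymmSquare.isOpenQuotientMap_mk.surjective z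
      obtain ⟨i, hi⟩ := Set.mem_iUnion.1 (hc ▸ Set.mem_univ p)
      refine Set.mem_sUnion.2 ⟨_, ⟨⟨i, by omega⟩, rfl⟩, p, ?_, rfl⟩
      convert hi using 2
      exact Fin.ext (min_eq_left (by simp; omega))
    · exact ⟨V 0, ⟨0, rfl⟩, Set.image_mono (hU _).diagonal_subset⟩
  exact AddSubgroup.mem_bot.1 (hbot ▸ hmem)
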